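/- Let $\lambda>-1/2$ and let $w^\lambda(x)=\frac{\Gamma(\lambda+1)}{\sqrt{\pi}\,\Gamma(\lambda+1/2)}(1-x^2)^{\lambda-1/2}$ be the unit Gegenbauer weight on $[-1,1]$. Let $G_n^\lambda$ ($n\ge 0$) be the orthonormal Gegenbauer polynomials, i.e. the polynomials of degree $n$ with positive leading coefficient, orthonormal with respect to $w^\lambda(x)\,dx$. With the Chebyshev polynomials $T_k(\cos\theta)=\cos k\theta$, put $$m_{k,n}^\lambda=\int_{-1}^1 T_k(x)\,\bigl(G_n^\lambda(x)\bigr)^2\,w^\lambda(x)\,dx ,\qquad k,n\ge 0 .$$ Write $(a)_k=a(a+1)\cdots(a+k-1)$, $(a)_0=1$, for the Pochhammer symbol. When $\lambda=0$, the $j=0$ term of the sums below is read as $0$ (this is its limit as $\lambda\to0$, the factor in front of the sum included). Then, for every integer $n\ge 0$: 1. for every integer $k\ge 1$, $$m_{2k,n}^{\lambda}=\frac{n+\lambda}{n!}\sum_{j=0}^n(-1)^j\binom{n}{j}\frac{(2\lambda+j)_n}{j+\lambda}\,\frac{(-j-\lambda)_k}{(j+\lambda+1)_k};$$ 2. for every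 integer $k\ge 0$ with $k>n+\lambda$, $$m_{2k,n}^{\lambda}=-\sin(\pi\lambda)\,\frac{n+\lambda}{\pi\,n!}\sum_{j=0}^n\binom{n}{j}\frac{(2\lambda+j)_n}{j+\lambda}\,\Gamma^2(j+\lambda+1)\,\frac{\Gamma(k-j-\lambda)}{\Gamma(k+j+\lambda+1)};$$ 3. if $\lambda$ is a non-negative integer, then $m_{2k,n}^\lambda=0$ for all $k\ge n+\lambda+1$; 4. $|m_{2k+2,n}^\lambda|\le|m_{2k,n}^\lambda|$ for every integer $k\ge 0$ with $k>n+\lambda$; 5. for fixed $n$ and $\lambda$, $|m_{2k,n}^\lambda|=O\bigl(k^{-2\lambda-1}\bigr)$ as $k\to+\infty$. -/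

import Mathlib

open MeasureTheory Polynomial

/-- The monic orthogonal polynomials of a measure `μ` on the real line, obtained by the
Gram-Schmidt process from the monomials `1, X, X ^ 2, …`:
`P_n = X ^ n - ∑_{j < n} (⟨X ^ n, P_j⟩ / ⟨P_j, P_j⟩) P_j`, with `⟨f, g⟩ = ∫ f g dμ`. -/
noncomputable def monicOrthogonalPoly (μ : Measure ℝ) : ℕ → ℝ[X]
  | n => X ^ n - ∑ j : Fin n,
      C ((∫ x, x ^ n * (monicOrthogonalPoly μ j.1).eval x ∂μ) /
          (∫ x, (monicOrthogonalPoly μ j.1).eval x ^ 2 ∂μ)) * monicOrthogonalPoly μ j.1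
  termination_by n => n
  decreasing_by all_goals exact j.2

/-- The orthonormal polynomial `p_n` of degree `n` with positive leading coefficient
associated with the measure `μ`. -/
noncomputable def orthonormalPoly (μ : Measure ℝ) (n : ℕ) : ℝ[X] :=
  C (√(∫ x, (monicOrthogonalPoly μ n).eval x ^ 2 ∂μ))⁻¹ * monicOrthogonalPoly μ n

/-- The measure `dν_n = p_n ^ 2 dμ`. -/
noncomputable def squaredMeasure (μ : Measure ℝ) (n : ℕ) : Measure ℝ :=
  μ.withDensity fun x => ENNReal.ofReal ((orthonormalPoly μ n).eval x ^ 2)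

/-- The generalized (Chebyshev) moments `m_{k,n} = ∫ T_k dν_n`. -/
noncomputable def chebyshevMoment (μ : Measure ℝ) (k n : ℕ) : ℝ :=
  ∫ x, (Chebyshev.T ℝ (k : ℤ)).eval x ∂(squaredMeasure μ n)

/-- The normalizing constant `c_λ = Γ(λ + 1) / (√π Γ(λ + 1/2))`. -/
noncomputable def gegenbauerConst (lam : ℝ) : ℝ :=
  Real.Gamma (lam + 1) / (√Real.pi * Real.Gamma (lam + 1 / 2))

/-- The unit Gegenbauer measure `w^λ(x) dx = c_λ (1 - x ^ 2) ^ (λ - 1/2) dx` on `[-1, 1]`. -/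
noncomputable def gegenbauerMeasure (lam : ℝ) : Measure ℝ :=
  (volume.restrict (Set.Icc (-1) 1)).withDensity fun x =>
    ENNReal.ofReal (gegenbauerConst lam * (1 - x ^ 2) ^ (lam - 1 / 2))

/-- The moments `m_{k,n}^λ` of the orthonormal Gegenbauer polynomials. -/
noncomputable def gegenbauerMoment (lam : ℝ) (k n : ℕ) : ℝ :=
  chebyshevMoment (gegenbauerMeasure lam) k n

/-- The Pochhammer symbol `(a)_k = a (a + 1) ⋯ (a + k - 1)`. -/
noncomputable def pochhammerSymbol (a : ℝ) (k : ℕ) : ℝ :=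
  (ascPochhammer ℝ k).eval a

/-! Let `ℓ` be integration against the Gegenbauer measure. Everything algebraic follows from
positivity of `ℓ` on squares and the Pearson identity `ℓ ((1 - x²) p' - (2λ + 1) x p) = 0`. Together
they force the orthogonal polynomial `y` of degree `n` to solve the Gegenbauer equation. Then `y²`
is even, `y² = A(1 - x²)`, and the coefficients of `A` obey a two-term recurrence (terminating
Clausen identity, `exists_sq_eq_comp`). The Pearson identity also evaluates `ℓ ((1 - x²)^j T_{2k})`
as `ℓ ((1 - x²)^j)` times a quotient of Pochhammer symbols. Hence `ℓ (y² T_{2k})` is a sum of these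
quotients whose coefficients are known up to one scalar; the case `k = 0` fixes the scalar, provided
the explicit solution of the recurrence can be summed (`sum_gegenbauerCoeff`, by finite
differences).

The other claims are read off this finite sum. Euler reflection gives the Gamma form; there, apart
from a common factor, all terms are nonnegative and decrease in `k`. For integral `λ` a Pochhammer
factor vanishes. Euler's limit formula for Gamma gives the decay of each term, the slowest possible
rate being that of `j = 0`. -/

/-! ### Gram-Schmidt orthogonal polynomials. -/

theorem monicOrthogonalPoly_eq (μ : Measure ℝ) (n : ℕ) :
    monicOrthogonalPoly μ n = X ^ n - ∑ j : Fin n,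
      C ((∫ x, x ^ n * (monicOrthogonalPoly μ j.1).eval x ∂μ) /
          (∫ x, (monicOrthogonalPoly μ j.1).eval x ^ 2 ∂μ)) * monicOrthogonalPoly μ j.1 := by
  rw [monicOrthogonalPoly]

theorem monicOrthogonalPoly_monic_natDegree (μ : Measure ℝ) (n : ℕ) :
    (monicOrthogonalPoly μ n).Monic ∧ (monicOrthogonalPoly μ n).natDegree = n := by
  induction n using Nat.strong_induction_on with
  | _ n ih =>
    have hdeg : (∑ j : Fin n,
        C ((∫ x, x ^ n * (monicOrthogonalPoly μ j.1).eval x ∂μ) /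
          (∫ x, (monicOrthogonalPoly μ j.1).eval x ^ 2 ∂μ)) *
          monicOrthogonalPoly μ j.1).degree < n := by
      refine (degree_sum_le _ _).trans_lt ?_
      refine (Finset.sup_lt_iff (WithBot.bot_lt_coe n)).2 fun j _ => ?_
      rw [← smul_eq_C_mul]
      refine (degree_smul_le _ _).trans_lt ?_
      rw [degree_eq_natDegree (ih j.1 j.2).1.ne_zero, (ih j.1 j.2).2]
      exact Nat.cast_lt.2 j.2
    rw [monicOrthogonalPoly_eq]
    refine ⟨monic_X_pow_sub hdeg, natDegree_eq_of_degree_eq_some ?_⟩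
    rw [degree_sub_eq_left_of_degree_lt (by rwa [degree_X_pow]), degree_X_pow]

theorem eq_zero_of_forall_lt {n : ℕ} (ℓ : ℝ[X] →ₗ[ℝ] ℝ) (P : ℕ → ℝ[X])
    (hP : ∀ m < n, (P m).Monic ∧ (P m).natDegree = m) (h : ∀ m < n, ℓ (P m) = 0) :
    ∀ q : ℝ[X], q.degree < n → ℓ q = 0 := by
  have key : ∀ m ≤ n, ∀ q : ℝ[X], q.degree < m → ℓ q = 0 := by
    intro m
    induction m with
    | zero =>
      intro _ q hq
      have : q = 0 := by simpa using hq
      simp [this]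
    | succ m ih =>
      intro hm q hq
      have hd : (q - C (q.coeff m) * P m).degree < m := by
        rw [degree_lt_iff_coeff_zero] at hq ⊢
        intro i hi
        rcases hi.eq_or_lt with rfl | hi
        · have := (hP m hm).1.coeff_natDegree
          rw [(hP m hm).2] at this
          simp [this]
        · rw [coeff_sub, coeff_C_mul, hq i hi,
            coeff_eq_zero_of_natDegree_lt (p := P m) (by rw [(hP m hm).2]; exact hi)]
          simp
      have := ih (by omega) _ hd
      rw [map_sub, ← smul_eq_C_mul, map_smul, h m hm] at this
      simpa using this
  exact key n le_rfl

section Moment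

variable {μ : Measure ℝ} (hμ : ∀ p : ℝ[X], Integrable (fun x => p.eval x) μ)

/-- Integration of polynomials against a measure with finite moments. -/
noncomputable def integralFunctional : ℝ[X] →ₗ[ℝ] ℝ where
  toFun p := ∫ x, p.eval x ∂μ
  map_add' p q := by
    simp only [eval_add]
    exact integral_add (hμ p) (hμ q)
  map_smul' c p := by
    simp only [eval_smul, smul_eq_mul, RingHom.id_apply]
    exact integral_const_mul _ _

theorem integralFunctional_apply (p : ℝ[X]) :
    integralFunctional hμ p = ∫ x, p.eval x ∂μ := rfl

theorem monicOrthogonalPoly_orthogonal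
    (hpos : ∀ p : ℝ[X], p ≠ 0 → 0 < integralFunctional hμ (p * p)) (n : ℕ) (q : ℝ[X])
    (hq : q.degree < n) : integralFunctional hμ (monicOrthogonalPoly μ n * q) = 0 := by
  have hmd := monicOrthogonalPoly_monic_natDegree μ
  induction n using Nat.strong_induction_on generalizing q with
  | _ n ih =>
    refine eq_zero_of_forall_lt
      ((integralFunctional hμ).comp (LinearMap.mulLeft ℝ (monicOrthogonalPoly μ n)))
      (monicOrthogonalPoly μ) (fun m _ => hmd m) (fun m hm => ?_) q hq
    have hlt : ∀ i j : ℕ, i < n → j < n → i ≠ j →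
        integralFunctional hμ (monicOrthogonalPoly μ i * monicOrthogonalPoly μ j) = 0 := by
      intro i j hi hj hij
      have hdeg : ∀ a, (monicOrthogonalPoly μ a).degree = a := fun a => by
        rw [degree_eq_natDegree (hmd a).1.ne_zero, (hmd a).2]
      rcases lt_or_gt_of_ne hij with h | h
      · rw [mul_comm]
        exact ih j hj _ (by rw [hdeg]; exact_mod_cast h)
      · exact ih i hi _ (by rw [hdeg]; exact_mod_cast h)
    -- Positivity makes the Gram-Schmidt denominator nonzero, so the projection term really cancels.
    have hne := (hpos _ (hmd m).1.ne_zero).ne'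
    have e1 : ∫ x, x ^ n * (monicOrthogonalPoly μ m).eval x ∂μ =
        integralFunctional hμ (X ^ n * monicOrthogonalPoly μ m) := by
      simp [integralFunctional_apply]
    have e2 : ∫ x, (monicOrthogonalPoly μ m).eval x ^ 2 ∂μ =
        integralFunctional hμ (monicOrthogonalPoly μ m * monicOrthogonalPoly μ m) := by
      simp [integralFunctional_apply, sq]
    rw [LinearMap.comp_apply, LinearMap.mulLeft_apply, monicOrthogonalPoly_eq μ n, sub_mul,
      map_sub, Finset.sum_mul, map_sum, Finset.sum_eq_single (⟨m, hm⟩ : Fin n)]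
    · rw [mul_assoc, ← smul_eq_C_mul, map_smul, e1, e2, smul_eq_mul, div_mul_cancel₀ _ hne,
        sub_self]
    · intro j _ hj
      rw [mul_assoc, ← smul_eq_C_mul, map_smul, hlt j m j.2 hm (fun h => hj (Fin.ext h)), smul_zero]
    · simp

end Moment

/-! ### The Gegenbauer differential equation. -/

/-- The Gegenbauer differential operator `(1 - x²) y'' - (2λ + 1) x y'`. -/
noncomputable def gegenbauerOp (lam : ℝ) (p : ℝ[X]) : ℝ[X] :=
  (1 - X ^ 2) * derivative (derivative p) - C (2 * lam + 1) * X * derivative p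

theorem coeff_gegenbauerOp (lam : ℝ) (p : ℝ[X]) (m : ℕ) :
    (gegenbauerOp lam p).coeff m =
      (m + 1) * (m + 2) * p.coeff (m + 2) - m * (m + 2 * lam) * p.coeff m := by
  have h2 : (1 - X ^ 2) * derivative (derivative p) =
    derivative (derivative p) - X * (X * derivative (derivative p)) := by ring
  rw [gegenbauerOp, h2, mul_assoc, coeff_sub, coeff_sub, coeff_C_mul]
  rcases m with _ | _ | m
  · simp [coeff_derivative]; ring
  · simp [coeff_derivative]; ring
  · simp only [coeff_derivative, coeff_X_mul]
    push_cast
    ring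

theorem degree_gegenbauerOp_lt (lam : ℝ) {p : ℝ[X]} {n : ℕ} (hp : p.degree < n) :
    (gegenbauerOp lam p).degree < n := by
  rw [degree_lt_iff_coeff_zero] at hp ⊢
  intro m hm
  rw [coeff_gegenbauerOp, hp m hm, hp (m + 2) (by omega)]
  ring

/-- The difference of the two sides is the Pearson identity applied to the Wronskian `p' q - p q'`.
-/
theorem gegenbauerOp_symm {lam : ℝ} {ℓ : ℝ[X] →ₗ[ℝ] ℝ}
    (hℓ : ∀ p, ℓ ((1 - X ^ 2) * derivative p - C (2 * lam + 1) * X * p) = 0) (p q : ℝ[X]) :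
    ℓ (gegenbauerOp lam p * q) = ℓ (p * gegenbauerOp lam q) := by
  rw [← sub_eq_zero, ← map_sub, ← hℓ (derivative p * q - p * derivative q)]
  congr 1
  simp only [gegenbauerOp, derivative_sub, derivative_mul]
  ring

/-- An orthogonal polynomial solves the Gegenbauer differential equation. -/
theorem gegenbauerOp_eq_of_orthogonal {lam : ℝ} {ℓ : ℝ[X] →ₗ[ℝ] ℝ}
    (hℓ : ∀ p, ℓ ((1 - X ^ 2) * derivative p - C (2 * lam + 1) * X * p) = 0)
    (hpos : ∀ p : ℝ[X], p ≠ 0 → 0 < ℓ (p * p)) {n : ℕ} {y : ℝ[X]} (hy : y.natDegree = n)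
    (horth : ∀ q : ℝ[X], q.degree < n → ℓ (y * q) = 0) :
    gegenbauerOp lam y + C (n * (n + 2 * lam)) * y = 0 := by
  set r := gegenbauerOp lam y + C (n * (n + 2 * lam)) * y with hr
  have hdeg : r.degree < n := by
    rw [degree_lt_iff_coeff_zero]
    intro m hm
    rw [hr, coeff_add, coeff_gegenbauerOp, coeff_C_mul,
      coeff_eq_zero_of_natDegree_lt (n := m + 2) (by omega)]
    rcases hm.eq_or_lt with rfl | hm
    · ring
    · rw [coeff_eq_zero_of_natDegree_lt (n := m) (by omega)]
      ring
  -- The leading terms cancelled, so `r` has degree below `n`; symmetry moves the operator onto `r`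
  -- without raising its degree, and orthogonality gives `ℓ (r * r) = 0`.
  by_contra hne
  refine (hpos r hne).ne' ?_
  nth_rw 1 [hr]
  rw [add_mul, map_add, gegenbauerOp_symm hℓ, horth _ (degree_gegenbauerOp_lt lam hdeg), mul_assoc,
    ← smul_eq_C_mul, map_smul, horth _ hdeg]
  simp

/-- For `m < n` the eigenvalues differ by `(n - m) (n + m + 2λ)`, which is nonzero because `λ >
-1/2`; so the leading coefficient of `p` must vanish. -/
theorem eq_zero_of_gegenbauerOp {lam : ℝ} (hlam : -(1 / 2) < lam) {n : ℕ} {p : ℝ[X]}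
    (hp : p.degree < n) (h : gegenbauerOp lam p + C (n * (n + 2 * lam)) * p = 0) : p = 0 := by
  by_contra hne
  have hlt : p.natDegree < n := (natDegree_lt_iff_degree_lt hne).2 hp
  have hc := congrArg (fun q => q.coeff p.natDegree) h
  simp only [coeff_add, coeff_gegenbauerOp, coeff_C_mul, coeff_zero,
    coeff_eq_zero_of_natDegree_lt (show p.natDegree < p.natDegree + 2 by omega)] at hc
  have hl : p.coeff p.natDegree ≠ 0 := by simpa using hne
  have h1 : (p.natDegree : ℝ) + 1 ≤ n := by exact_mod_cast hlt
  have h0 : (0 : ℝ) ≤ p.natDegree := Nat.cast_nonneg _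
  have h3 : ((n : ℝ) - p.natDegree) * (n + p.natDegree + 2 * lam) * p.coeff p.natDegree = 0 := by
    linear_combination hc
  have h4 : ((n : ℝ) - p.natDegree) * (n + p.natDegree + 2 * lam) ≠ 0 :=
    mul_ne_zero (by linarith) (by linarith)
  exact (mul_ne_zero h4 hl) h3

theorem gegenbauerOp_comp_neg_X (lam : ℝ) (p : ℝ[X]) :
    gegenbauerOp lam (p.comp (-X)) = (gegenbauerOp lam p).comp (-X) := by
  simp only [gegenbauerOp, derivative_comp, derivative_mul, sub_comp, mul_comp, C_comp,
    X_comp, pow_comp, one_comp, derivative_neg, derivative_X, derivative_one]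
  ring

/-- The equation is invariant under `x ↦ -x`, and `y(-x) - (-1)^n y(x)` is a solution of degree
below `n`, hence zero. -/
theorem comp_neg_X_of_gegenbauerOp {lam : ℝ} (hlam : -(1 / 2) < lam) {n : ℕ} {y : ℝ[X]}
    (hy : y.natDegree = n) (h : gegenbauerOp lam y + C (n * (n + 2 * lam)) * y = 0) :
    y.comp (-X) = C ((-1) ^ n) * y := by
  rw [← sub_eq_zero]
  have hco : ∀ m, (y.comp (-X)).coeff m = (-1) ^ m * y.coeff m := fun m => by
    rw [show (-X : ℝ[X]) = C (-1) * X by simp, comp_C_mul_X_coeff]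
    ring
  refine eq_zero_of_gegenbauerOp hlam (n := n) ?_ ?_
  · rw [degree_lt_iff_coeff_zero]
    intro m hm
    rw [coeff_sub, coeff_C_mul, hco]
    rcases hm.eq_or_lt with rfl | hm
    · ring
    · rw [coeff_eq_zero_of_natDegree_lt (n := m) (by omega)]
      ring
  · have h1 := gegenbauerOp_comp_neg_X lam y
    have h2 := congrArg (fun q => q.comp (-X)) h
    simp only [add_comp, mul_comp, C_comp, zero_comp] at h2
    have h3 : gegenbauerOp lam (y.comp (-X) - C ((-1) ^ n) * y) =
        gegenbauerOp lam (y.comp (-X)) - C ((-1) ^ n) * gegenbauerOp lam y := by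
      simp only [gegenbauerOp, derivative_sub, derivative_C_mul]
      ring
    rw [h3, h1]
    linear_combination h2 - C ((-1) ^ n) * h

/-! ### The square of a solution as a polynomial in `1 - x²`. -/

theorem exists_comp_one_sub_X_sq {v : ℝ[X]} (hv : v.comp (-X) = v) :
    ∃ A : ℝ[X], v = A.comp (1 - X ^ 2) := by
  have hodd : ∀ m, Odd m → v.coeff m = 0 := fun m hm => by
    have h := congrArg (fun q => q.coeff m) hv
    simp only [show (-X : ℝ[X]) = C (-1) * X by simp, comp_C_mul_X_coeff, hm.neg_one_pow] at h
    linarith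
  refine ⟨(contract 2 v).comp (1 - X), ?_⟩
  have h2 : v = expand ℝ 2 (contract 2 v) := by
    ext m
    rw [coeff_expand two_pos]
    split_ifs with h
    · rw [coeff_contract two_ne_zero, Nat.div_mul_cancel h]
    · exact hodd m (by rwa [← Nat.not_even_iff_odd, even_iff_two_dvd])
  rw [comp_assoc]
  conv_lhs => rw [h2, expand_eq_comp_X_pow]
  congr 1
  simp

theorem comp_one_sub_X_sq_injective {p : ℝ[X]} (h : p.comp (1 - X ^ 2) = 0) : p = 0 := by
  have hd : (1 - X ^ 2 : ℝ[X]).natDegree = 2 := by compute_degree!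
  have := natDegree_comp (p := p) (q := (1 - X ^ 2 : ℝ[X]))
  rcases comp_eq_zero_iff.1 h with h | ⟨_, h⟩
  · exact h
  · rw [h, natDegree_C] at hd
    omega

/-- The expansion in powers of `1 - x²` of the square of a polynomial solution of the Gegenbauer
equation: a terminating case of Clausen's identity. -/
theorem exists_sq_eq_comp {lam : ℝ} (hlam : -(1 / 2) < lam) {n : ℕ} {y : ℝ[X]}
    (hy : y.natDegree = n) (h : gegenbauerOp lam y + C (n * (n + 2 * lam)) * y = 0) :
    ∃ A : ℝ[X], y * y = A.comp (1 - X ^ 2) ∧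
      (2 * lam + 1) * A.coeff 1 = -(n * (n + 2 * lam)) * A.coeff 0 ∧
      ∀ j : ℕ, (j + 2 * lam) * (j + 1) * (j + lam + 1 / 2) * A.coeff (j + 1) =
        -(j + lam) * (n - j) * (n + j + 2 * lam) * A.coeff j := by
  have hpar := comp_neg_X_of_gegenbauerOp hlam hy h
  obtain ⟨A, hA⟩ := exists_comp_one_sub_X_sq (v := y * y) (by
    rw [mul_comp, hpar]
    have : C ((-1 : ℝ) ^ n) * C ((-1) ^ n) = 1 := by
      rw [← C_mul, ← mul_pow]; simp
    linear_combination (y * y) * this)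
  refine ⟨A, hA, ?_⟩
  set N : ℝ := n * (n + 2 * lam)
  -- `w` is `2 s y'²` written in the variable `s = 1 - x²`, with `y''` eliminated by the equation.
  set w : ℝ[X] := X * (-2 * derivative A + 4 * (1 - X) * derivative (derivative A)) +
    C (2 * (2 * lam + 1)) * (1 - X) * derivative A + C (2 * N) * A with hw
  have hd1 : 2 * y * derivative y = -2 * X * (derivative A).comp (1 - X ^ 2) := by
    have := congrArg derivative hA
    simp only [derivative_mul, derivative_comp, derivative_sub, derivative_one,
      derivative_X_pow] at this
    simp only [Nat.cast_ofNat, map_ofNat] at this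
    linear_combination this
  have hd2 : 2 * derivative y ^ 2 + 2 * y * derivative (derivative y) =
      -2 * (derivative A).comp (1 - X ^ 2) +
        4 * X ^ 2 * (derivative (derivative A)).comp (1 - X ^ 2) := by
    have := congrArg derivative hd1
    simp only [derivative_mul, derivative_comp, derivative_sub, derivative_one, derivative_neg,
      derivative_X, derivative_ofNat, derivative_X_pow] at this
    simp only [Nat.cast_ofNat, map_ofNat] at this
    linear_combination this
  have hode : (1 - X ^ 2) * derivative (derivative y) =
      C (2 * lam + 1) * X * derivative y - C N * y := by
    rw [gegenbauerOp] at h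
    linear_combination h
  have hwc : w.comp (1 - X ^ 2) = 2 * (1 - X ^ 2) * derivative y ^ 2 := by
    simp only [hw, add_comp, mul_comp, sub_comp, one_comp, X_comp, C_comp, neg_comp, ofNat_comp]
    simp only [C_mul, map_ofNat]
    linear_combination (-(1 - X ^ 2)) * hd2 + C (2 * lam + 1) * X * hd1 - 2 * C N * hA +
      2 * y * hode
  have hw' : X * w.derivative.comp (1 - X ^ 2) =
      2 * X * derivative y ^ 2 -
        2 * (1 - X ^ 2) * derivative y * derivative (derivative y) := by
    have := congrArg derivative hwc
    simp only [derivative_mul, derivative_comp, derivative_sub, derivative_one, derivative_pow,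
      derivative_X, derivative_ofNat] at this
    simp only [Nat.cast_ofNat, map_ofNat] at this
    have h2 : (2 : ℝ[X]) ≠ 0 := two_ne_zero
    apply mul_left_cancel₀ h2
    linear_combination -this
  -- Differentiating `w` and eliminating `y''` again gives the third-order equation for `y²`, here
  -- first order in `w`.
  have hrec : X * derivative w + C (2 * lam) * w + C (2 * N) * X * derivative A = 0 := by
    apply comp_one_sub_X_sq_injective
    have hX : (X : ℝ[X]) ≠ 0 := X_ne_zero
    apply mul_left_cancel₀ hX
    simp only [add_comp, mul_comp, X_comp, C_comp, hwc]
    simp only [C_mul, map_add, map_ofNat, map_one] at *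
    linear_combination (1 - X ^ 2) * hw' - 2 * (1 - X ^ 2) * derivative y * hode
      + C N * (1 - X ^ 2) * hd1
  -- This is the value at `x = 1`. It yields the relation between the first two coefficients, which
  -- the general recurrence loses when `λ = 0`.
  have hw0 : w.coeff 0 = 0 := by
    have := congrArg (eval 1) hwc
    simpa [eval_comp, coeff_zero_eq_eval_zero] using this
  have hco : ∀ j : ℕ, w.coeff j = (j + 1) * (4 * j + 4 * lam + 2) * A.coeff (j + 1) +
      (2 * N - 4 * j ^ 2 - 4 * lam * j) * A.coeff j := by
    intro j
    have e : w = C (-2) * (X * derivative A) + C 4 * (X * derivative (derivative A)) -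
        C 4 * (X * (X * derivative (derivative A))) + C (2 * (2 * lam + 1)) * derivative A -
        C (2 * (2 * lam + 1)) * (X * derivative A) + C (2 * N) * A := by
      rw [hw]; simp only [C_neg, map_ofNat]; ring
    rw [e]
    simp only [coeff_add, coeff_sub, coeff_C_mul]
    rcases j with _ | _ | j
    · simp only [mul_coeff_zero, coeff_X_zero, coeff_derivative]
      push_cast
      ring
    · simp [coeff_derivative]; ring
    · simp only [coeff_derivative, coeff_X_mul]
      push_cast
      ring
  constructor
  · have := hco 0
    rw [hw0] at this
    push_cast at this
    simp only [zero_add] at this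
    linear_combination -this / 2
  · intro j
    have h1 : (j + 2 * lam) * w.coeff j + 2 * N * j * A.coeff j = 0 := by
      have := congrArg (fun q => q.coeff j) hrec
      simp only [mul_assoc, coeff_add, coeff_C_mul, coeff_zero] at this
      rcases j with _ | j
      · simp [hw0]
      · simp only [coeff_X_mul, coeff_derivative] at this
        push_cast
        linear_combination this
    rw [hco] at h1
    linear_combination h1 / 4

/-! ### Pochhammer symbols and alternating binomial sums. -/

theorem pochhammerSymbol_zero (a : ℝ) : pochhammerSymbol a 0 = 1 := by
  simp [pochhammerSymbol]

theorem pochhammerSymbol_succ (a : ℝ) (k : ℕ) :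
    pochhammerSymbol a (k + 1) = pochhammerSymbol a k * (a + k) :=
  ascPochhammer_succ_eval k a

theorem pochhammerSymbol_succ_left (a : ℝ) (k : ℕ) :
    pochhammerSymbol a (k + 1) = a * pochhammerSymbol (a + 1) k := by
  simp [pochhammerSymbol, ascPochhammer_succ_left, eval_comp]

theorem pochhammerSymbol_ne_zero {a : ℝ} {k : ℕ} (h : ∀ i < k, a + i ≠ 0) :
    pochhammerSymbol a k ≠ 0 := by
  induction k with
  | zero => simp [pochhammerSymbol_zero]
  | succ k ih =>
    rw [pochhammerSymbol_succ]
    exact mul_ne_zero (ih fun i hi => h i (by omega)) (h k (by omega))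

theorem pochhammerSymbol_eq_zero {a : ℝ} {k i : ℕ} (hi : i < k) (h : a + i = 0) :
    pochhammerSymbol a k = 0 := by
  induction k with
  | zero => omega
  | succ k ih =>
    rw [pochhammerSymbol_succ]
    rcases (Nat.lt_succ_iff.1 hi).eq_or_lt with rfl | hi
    · rw [h, mul_zero]
    · rw [ih hi, zero_mul]

theorem pochhammerSymbol_one (n : ℕ) : pochhammerSymbol 1 n = n.factorial := by
  simp [pochhammerSymbol, ascPochhammer_eval_one]

theorem sum_neg_one_pow_mul_choose (f : ℝ → ℝ) (n : ℕ) (y : ℝ) :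
    ∑ j ∈ Finset.range (n + 1), (-1 : ℝ) ^ j * (n.choose j : ℝ) * f (y + j) =
      (-1) ^ n * (fwdDiff 1)^[n] f y := by
  rw [fwdDiff_iter_eq_sum_shift, Finset.mul_sum]
  refine Finset.sum_congr rfl fun j hj => ?_
  have hj : j ≤ n := Nat.lt_succ_iff.1 (Finset.mem_range.1 hj)
  obtain ⟨i, rfl⟩ := Nat.exists_eq_add_of_le hj
  have : (-1 : ℝ) ^ (j + i) * (-1) ^ i = (-1) ^ j := by
    rw [pow_add, mul_assoc, ← mul_pow]; simp
  simp only [zsmul_eq_mul, nsmul_eq_mul, mul_one, add_tsub_cancel_left]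
  push_cast
  rw [← this]
  ring

theorem sum_neg_one_pow_mul_choose_mul_eval {p : ℝ[X]} {n : ℕ} (hp : p.natDegree < n) :
    ∑ j ∈ Finset.range (n + 1), (-1 : ℝ) ^ j * (n.choose j : ℝ) * p.eval (j : ℝ) = 0 := by
  have := sum_neg_one_pow_mul_choose (fun x => p.eval x) n 0
  rw [fwdDiff_iter_eq_zero_of_degree_lt hp] at this
  simpa using this

theorem fwdDiff_iter_inv (n : ℕ) (x : ℝ) (hx : ∀ i : ℕ, x + i ≠ 0) :
    (fwdDiff 1)^[n] (fun t : ℝ => t⁻¹) x =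
      (-1) ^ n * (n.factorial / pochhammerSymbol x (n + 1)) := by
  induction n generalizing x with
  | zero => simp [pochhammerSymbol_succ, pochhammerSymbol_zero]
  | succ n ih =>
    have hx' : ∀ i : ℕ, x + 1 + i ≠ 0 := fun i => by
      have := hx (i + 1)
      push_cast at this
      rwa [add_right_comm, add_assoc]
    rw [Function.iterate_succ_apply', fwdDiff, ih x hx, ih (x + 1) hx',
      pochhammerSymbol_succ x (n + 1), pochhammerSymbol_succ_left x n,
      pochhammerSymbol_succ (x + 1) n, Nat.factorial_succ]
    have h0 : x ≠ 0 := by simpa using hx 0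
    have h1 : pochhammerSymbol (x + 1) n ≠ 0 := pochhammerSymbol_ne_zero fun i _ => hx' i
    have h2 := hx' n
    have h3 : x + (n + 1) ≠ 0 := by simpa using hx (n + 1)
    push_cast
    field_simp
    ring

/-- Write `p(t) = p(-x) + (t + x) q(t)`. The `n`-th difference kills `q`, of degree below `n`, and
only the difference of `1/t` remains. -/
theorem sum_neg_one_pow_mul_choose_mul_eval_div (p : ℝ[X]) {n : ℕ} (hp : p.natDegree ≤ n)
    (x : ℝ) (hx : ∀ i : ℕ, x + i ≠ 0) :
    ∑ j ∈ Finset.range (n + 1), (-1 : ℝ) ^ j * (n.choose j : ℝ) * (p.eval (j : ℝ) / (j + x)) =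
      p.eval (-x) * (n.factorial / pochhammerSymbol x (n + 1)) := by
  have h1 := sum_neg_one_pow_mul_choose (fun t => t⁻¹) n x
  rw [fwdDiff_iter_inv n x hx, ← mul_assoc, ← mul_pow] at h1
  simp only [mul_neg, mul_one, neg_neg, one_pow, one_mul] at h1
  have hroot : (p - C (p.eval (-x))).IsRoot (-x) := by simp
  obtain ⟨q, hq⟩ := dvd_iff_isRoot.2 hroot
  have hev : ∀ j : ℕ, p.eval (j : ℝ) / (j + x) = q.eval (j : ℝ) + p.eval (-x) * (x + j)⁻¹ := by
    intro j
    have h := congrArg (eval (j : ℝ)) hq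
    simp only [eval_sub, eval_C, eval_mul, eval_X] at h
    have := hx j
    rw [add_comm (j : ℝ)]
    field_simp
    linear_combination h
  have hq0 : ∑ j ∈ Finset.range (n + 1), (-1 : ℝ) ^ j * (n.choose j : ℝ) * q.eval (j : ℝ) = 0 := by
    by_cases hq' : q = 0
    · simp [hq']
    · apply sum_neg_one_pow_mul_choose_mul_eval
      have h := congrArg natDegree hq
      rw [natDegree_sub_C, natDegree_mul (X_sub_C_ne_zero _) hq', natDegree_X_sub_C] at h
      omega
  simp only [hev, mul_add, Finset.sum_add_distrib, hq0, zero_add]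
  rw [← h1, Finset.mul_sum]
  exact Finset.sum_congr rfl fun j _ => by ring

/-! ### The explicit coefficients and their sum. -/

/-- The coefficients of the expansion of the moments of the Gegenbauer polynomials, up to a
factor. -/
noncomputable def gegenbauerCoeff (lam : ℝ) (n j : ℕ) : ℝ :=
  (-1 : ℝ) ^ j * (n.choose j : ℝ) * (pochhammerSymbol (2 * lam + j) n / ((j : ℝ) + lam))

theorem gegenbauerCoeff_succ (lam : ℝ) (n j : ℕ) (h0 : (j : ℝ) + lam ≠ 0)
    (h1 : (j : ℝ) + lam + 1 ≠ 0) :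
    (j + 2 * lam) * (j + 1) * (j + lam + 1) * gegenbauerCoeff lam n (j + 1) =
      -(j + lam) * (n - j) * (n + j + 2 * lam) * gegenbauerCoeff lam n j := by
  have e1 : ((n.choose (j + 1) : ℕ) : ℝ) * (j + 1) = n.choose j * (n - j) := by
    rcases le_or_gt j n with h | h
    · have := Nat.choose_succ_right_eq n j
      rw [← Nat.cast_sub h]
      exact_mod_cast this
    · rw [Nat.choose_eq_zero_of_lt h, Nat.choose_eq_zero_of_lt (by omega)]
      simp
  have e2 : (2 * lam + j) * pochhammerSymbol (2 * lam + (j + 1)) n =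
      pochhammerSymbol (2 * lam + j) n * (2 * lam + j + n) := by
    rw [← pochhammerSymbol_succ, pochhammerSymbol_succ_left, add_assoc]
  rw [gegenbauerCoeff, gegenbauerCoeff]
  push_cast
  rw [show (j : ℝ) + 1 + lam = j + lam + 1 by ring, pow_succ]
  field_simp
  linear_combination (-pochhammerSymbol (2 * lam + (j + 1)) n * (j + 2 * lam)) * e1 -
    (n.choose j * (n - j)) * e2

theorem sum_gegenbauerCoeff {lam : ℝ} (hlam : -(1 / 2) < lam) (h0 : lam ≠ 0) (n : ℕ) :
    ∑ j ∈ Finset.range (n + 1), gegenbauerCoeff lam n j = n.factorial / (n + lam) := by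
  have hx : ∀ i : ℕ, lam + i ≠ 0 := by
    rintro (_ | i)
    · simpa using h0
    · have : (0 : ℝ) ≤ i := Nat.cast_nonneg i
      push_cast
      linarith
  have hdeg : ((ascPochhammer ℝ n).comp (X + C (2 * lam))).natDegree ≤ n := by
    rw [natDegree_comp, natDegree_X_add_C, ascPochhammer_natDegree, mul_one]
  have h := sum_neg_one_pow_mul_choose_mul_eval_div _ hdeg lam hx
  simp only [eval_comp, eval_add, eval_X, eval_C] at h
  have e : ∀ j : ℕ, (ascPochhammer ℝ n).eval (j + 2 * lam) = pochhammerSymbol (2 * lam + j) n :=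
    fun j => by rw [pochhammerSymbol, add_comm]
  -- At the pole `t = -λ` the numerator `(2λ + t)_n` is `(λ)_n`, which cancels all but the last
  -- factor of `(λ)_{n+1}`.
  have e' : (ascPochhammer ℝ n).eval (-lam + 2 * lam) = pochhammerSymbol lam n := by
    rw [pochhammerSymbol]; congr 1; ring
  simp only [e, e'] at h
  simp only [gegenbauerCoeff]
  rw [h, pochhammerSymbol_succ]
  have h1 : pochhammerSymbol lam n ≠ 0 := pochhammerSymbol_ne_zero fun i _ => hx i
  have h2 := hx n
  rw [add_comm (n : ℝ)]
  field_simp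

/-- `2 (n - 1)!` is the limit of `(2λ)_n / λ`, whereas the literal `j = 0` coefficient is `0` by
division by zero. For `j ≥ 1`, `(j)_n / j = (j + 1)_{n-1}` has degree `n - 1` in `j`, so its full
alternating sum vanishes. -/
theorem sum_gegenbauerCoeff_zero {n : ℕ} (hn : n ≠ 0) :
    2 * ((n - 1).factorial : ℝ) + ∑ j ∈ Finset.range n, gegenbauerCoeff 0 n (j + 1) =
      n.factorial / n := by
  obtain ⟨n, rfl⟩ := Nat.exists_eq_succ_of_ne_zero hn
  have hdeg : ((ascPochhammer ℝ n).comp (X + C 1)).natDegree < n + 1 := by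
    rw [natDegree_comp, natDegree_X_add_C, ascPochhammer_natDegree]
    omega
  have h := sum_neg_one_pow_mul_choose_mul_eval hdeg
  rw [Finset.sum_range_succ'] at h
  simp only [eval_comp, eval_add, eval_X, eval_C] at h
  simp only [Nat.cast_zero, zero_add, ascPochhammer_eval_one, pow_zero, Nat.choose_zero_right,
    Nat.cast_one, one_mul] at h
  have e : ∀ j : ℕ, gegenbauerCoeff 0 (n + 1) (j + 1) = (-1) ^ (j + 1) *
      ((n + 1).choose (j + 1) : ℕ) * (ascPochhammer ℝ n).eval (((j + 1 : ℕ) : ℝ) + 1) := by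
    intro j
    have : (j : ℝ) + 1 ≠ 0 := by positivity
    rw [gegenbauerCoeff, pochhammerSymbol_succ_left]
    simp only [pochhammerSymbol]
    push_cast
    simp only [mul_zero, zero_add, add_zero]
    field_simp
  simp only [Nat.succ_eq_add_one, e, Nat.add_sub_cancel, Nat.factorial_succ]
  have : (n : ℝ) + 1 ≠ 0 := by positivity
  push_cast at h ⊢
  field_simp
  linear_combination h

/-! ### Moments under a functional satisfying the Pearson identity. -/

/-- The Chebyshev moments of the Gegenbauer weight of parameter `j + λ`. -/
noncomputable def weightMoment (lam : ℝ) (k j : ℕ) : ℝ :=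
  pochhammerSymbol (-(j : ℝ) - lam) k / pochhammerSymbol ((j : ℝ) + lam + 1) k

theorem weightMoment_zero_left (lam : ℝ) (j : ℕ) : weightMoment lam 0 j = 1 := by
  simp [weightMoment, pochhammerSymbol_zero]

theorem weightMoment_succ {lam : ℝ} (k j : ℕ) (h : (j : ℝ) + lam + 1 + k ≠ 0) :
    (k + 1 + j + lam) * weightMoment lam (k + 1) j = (k - j - lam) * weightMoment lam k j := by
  rw [weightMoment, weightMoment, pochhammerSymbol_succ, pochhammerSymbol_succ,
    mul_div_mul_comm, show (k : ℝ) + 1 + j + lam = j + lam + 1 + k by ring]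
  field_simp
  ring

theorem derivative_one_sub_X_sq_pow (j : ℕ) :
    (1 - X ^ 2) * derivative ((1 - X ^ 2 : ℝ[X]) ^ j) = -2 * C (j : ℝ) * X * (1 - X ^ 2) ^ j := by
  rcases j with _ | j
  · simp
  · rw [derivative_pow]
    simp only [derivative_sub, derivative_one, derivative_X_pow, Nat.add_sub_cancel]
    simp only [Nat.cast_ofNat, map_ofNat]
    ring

section Functional

variable {lam : ℝ} {ℓ : ℝ[X] →ₗ[ℝ] ℝ}

theorem functional_one_sub_X_sq_pow_succ
    (hℓ : ∀ p, ℓ ((1 - X ^ 2) * derivative p - C (2 * lam + 1) * X * p) = 0) (j : ℕ) :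
    (j + lam + 1) * ℓ ((1 - X ^ 2) ^ (j + 1)) = (j + lam + 1 / 2) * ℓ ((1 - X ^ 2) ^ j) := by
  -- This test polynomial makes the Pearson identity a two-term relation in `j`.
  have h := hℓ (X * (1 - X ^ 2) ^ j)
  have e : (1 - X ^ 2) * derivative (X * (1 - X ^ 2) ^ j) -
      C (2 * lam + 1) * X * (X * (1 - X ^ 2) ^ j) =
      C (2 * (j + lam + 1)) * (1 - X ^ 2) ^ (j + 1) -
        C (2 * (j + lam + 1 / 2)) * (1 - X ^ 2) ^ j := by
    have h2 : C (2 * ((j : ℝ) + lam + 1 / 2)) = 2 * C (j : ℝ) + 2 * C lam + 1 := by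
      rw [← map_ofNat C 2, ← C_mul, ← C_mul, ← C_1, ← C_add, ← C_add]
      congr 1; ring
    rw [h2, derivative_mul, derivative_X]
    simp only [C_mul, C_add, map_ofNat, map_one]
    linear_combination X * derivative_one_sub_X_sq_pow j
  rw [e, map_sub, ← smul_eq_C_mul, ← smul_eq_C_mul, map_smul, map_smul, smul_eq_mul,
    smul_eq_mul] at h
  linear_combination h / 2

theorem functional_one_sub_X_sq_pow_mul_T_succ
    (hℓ : ∀ p, ℓ ((1 - X ^ 2) * derivative p - C (2 * lam + 1) * X * p) = 0) (k j : ℕ) :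
    (k + 1 + j + lam) * ℓ ((1 - X ^ 2) ^ j * Chebyshev.T ℝ (2 * (k + 1 : ℕ) : ℕ)) =
      (k - j - lam) * ℓ ((1 - X ^ 2) ^ j * Chebyshev.T ℝ (2 * k : ℕ)) := by
  -- Since `(1 - X²) U_{2k} = X T_{2k+1} - T_{2k+2}`, and `X T_{2k+1}` is the mean of its even
  -- neighbours, only `T_{2k}` and `T_{2k+2}` survive.
  have h := hℓ ((1 - X ^ 2) ^ j * Chebyshev.T ℝ (2 * k + 1))
  have hT : Chebyshev.T ℝ (2 * k + 2) =
      2 * X * Chebyshev.T ℝ (2 * k + 1) - Chebyshev.T ℝ (2 * k) := Chebyshev.T_add_two ℝ (2 * k)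
  have hU := Chebyshev.one_sub_X_sq_mul_U_eq_pol_in_T ℝ (2 * k)
  have hd : derivative (Chebyshev.T ℝ (2 * k + 1)) =
      (2 * C (k : ℝ) + 1) * Chebyshev.U ℝ (2 * k) := by
    rw [Chebyshev.T_derivative_eq_U, add_sub_cancel_right]
    push_cast
    simp
  have e : (1 - X ^ 2) * derivative ((1 - X ^ 2) ^ j * Chebyshev.T ℝ (2 * k + 1)) -
      C (2 * lam + 1) * X * ((1 - X ^ 2) ^ j * Chebyshev.T ℝ (2 * k + 1)) =
      C (k - j - lam) * ((1 - X ^ 2) ^ j * Chebyshev.T ℝ (2 * k)) -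
        C (k + 1 + j + lam) * ((1 - X ^ 2) ^ j * Chebyshev.T ℝ (2 * k + 2)) := by
    rw [derivative_mul, hd]
    simp only [C_mul, C_add, C_sub, map_ofNat, map_one]
    linear_combination Chebyshev.T ℝ (2 * k + 1) * derivative_one_sub_X_sq_pow j +
      (1 - X ^ 2) ^ j * (2 * C (k : ℝ) + 1) * hU +
      (1 - X ^ 2) ^ j * (-C (k : ℝ) + C (j : ℝ) + C lam) * hT
  rw [e, map_sub, ← smul_eq_C_mul, ← smul_eq_C_mul, map_smul, map_smul, smul_eq_mul,
    smul_eq_mul] at h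
  push_cast
  rw [show (2 * ((k : ℤ) + 1)) = 2 * k + 2 by ring]
  linear_combination -h

theorem functional_one_sub_X_sq_pow_mul_T (hlam : -(1 / 2) < lam)
    (hℓ : ∀ p, ℓ ((1 - X ^ 2) * derivative p - C (2 * lam + 1) * X * p) = 0) (k j : ℕ) :
    ℓ ((1 - X ^ 2) ^ j * Chebyshev.T ℝ (2 * k : ℕ)) =
      ℓ ((1 - X ^ 2) ^ j) * weightMoment lam k j := by
  induction k with
  | zero => simp [weightMoment_zero_left]
  | succ k ih =>
    have hk : (0 : ℝ) ≤ k := Nat.cast_nonneg k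
    have hj : (0 : ℝ) ≤ j := Nat.cast_nonneg j
    have hne : (k + 1 + j + lam : ℝ) ≠ 0 := by linarith
    apply mul_left_cancel₀ hne
    have h1 := functional_one_sub_X_sq_pow_mul_T_succ hℓ k j
    have h2 := weightMoment_succ (lam := lam) k j (by linarith)
    rw [h1, ih]
    linear_combination -ℓ ((1 - X ^ 2) ^ j) * h2

/-- The modified moments of `y ^ 2` expand in the moments of the weights `(1 - x ^ 2) ^ j`. -/
theorem exists_functional_sq_mul_T (hlam : -(1 / 2) < lam)
    (hℓ : ∀ p, ℓ ((1 - X ^ 2) * derivative p - C (2 * lam + 1) * X * p) = 0) {n : ℕ} {y : ℝ[X]}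
    (hy : y.natDegree = n) (h : gegenbauerOp lam y + C (n * (n + 2 * lam)) * y = 0) :
    ∃ α : ℕ → ℝ,
      (∀ k : ℕ, ℓ (y * y * Chebyshev.T ℝ (2 * k : ℕ)) =
        ∑ j ∈ Finset.range (n + 1), α j * weightMoment lam k j) ∧
      2 * (lam + 1) * α 1 = -(n * (n + 2 * lam)) * α 0 ∧
      ∀ j : ℕ, (j + 2 * lam) * (j + 1) * (j + lam + 1) * α (j + 1) =
        -(j + lam) * (n - j) * (n + j + 2 * lam) * α j := by
  obtain ⟨A, hA, h1, hrec⟩ := exists_sq_eq_comp hlam hy h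
  have hs : (1 - X ^ 2 : ℝ[X]).natDegree = 2 := by compute_degree!
  have hd : A.natDegree = n := by
    have hdeg := congrArg natDegree hA
    rw [natDegree_comp, hs, ← sq, natDegree_pow, hy] at hdeg
    omega
  have hb := functional_one_sub_X_sq_pow_succ hℓ
  refine ⟨fun j => A.coeff j * ℓ ((1 - X ^ 2) ^ j), fun k => ?_, ?_, fun j => ?_⟩
  · have e : A.comp (1 - X ^ 2) =
        ∑ j ∈ Finset.range (n + 1), C (A.coeff j) * (1 - X ^ 2) ^ j := by
      rw [comp, eval₂_eq_sum_range, hd]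
    rw [hA, e, Finset.sum_mul, map_sum]
    refine Finset.sum_congr rfl fun j _ => ?_
    rw [mul_assoc, ← smul_eq_C_mul, map_smul, functional_one_sub_X_sq_pow_mul_T hlam hℓ,
      smul_eq_mul, mul_assoc]
  · have hb0 := hb 0
    simp only [Nat.cast_zero, zero_add] at hb0
    linear_combination 2 * A.coeff 1 * hb0 + ℓ ((1 - X ^ 2) ^ 0) * h1
  · linear_combination (j + 2 * lam) * (j + 1) * A.coeff (j + 1) * hb j +
      ℓ ((1 - X ^ 2) ^ j) * hrec j

/-- A sequence subject to the same recurrence as the coefficients of `y ^ 2` computes the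
normalized moments. -/
theorem functional_sq_mul_T_mul_sum (hlam : -(1 / 2) < lam)
    (hℓ : ∀ p, ℓ ((1 - X ^ 2) * derivative p - C (2 * lam + 1) * X * p) = 0) {n : ℕ} {y : ℝ[X]}
    (hy : y.natDegree = n) (h : gegenbauerOp lam y + C (n * (n + 2 * lam)) * y = 0)
    {t : ℕ → ℝ} (ht0 : t 0 ≠ 0)
    (ht1 : 2 * (lam + 1) * t 1 = -(n * (n + 2 * lam)) * t 0)
    (ht : ∀ j : ℕ, j ≠ 0 → (j + 2 * lam) * (j + 1) * (j + lam + 1) * t (j + 1) =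
      -(j + lam) * (n - j) * (n + j + 2 * lam) * t j) (k : ℕ) :
    ℓ (y * y * Chebyshev.T ℝ (2 * k : ℕ)) * ∑ j ∈ Finset.range (n + 1), t j =
      ℓ (y * y) * ∑ j ∈ Finset.range (n + 1), t j * weightMoment lam k j := by
  obtain ⟨α, hα, hα1, hαrec⟩ := exists_functional_sq_mul_T hlam hℓ hy h
  -- The recurrence has nonzero leading factor for `j ≥ 1`; the separate relation covers `j = 0`, so
  -- solutions are proportional.
  have key : ∀ j, α j = α 0 / t 0 * t j := by
    intro j
    induction j with
    | zero => field_simp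
    | succ j ih =>
      rcases Nat.eq_zero_or_pos j with rfl | hj
      · have : 2 * (lam + 1) ≠ 0 := by linarith
        apply mul_left_cancel₀ this
        rw [zero_add, hα1]
        field_simp
        linear_combination -α 0 * ht1
      · have hj1 : (1 : ℝ) ≤ j := by exact_mod_cast hj
        have : ((j : ℝ) + 2 * lam) * (j + 1) * (j + lam + 1) ≠ 0 :=
          mul_ne_zero (mul_ne_zero (by linarith) (by linarith)) (by linarith)
        apply mul_left_cancel₀ this
        rw [hαrec, ih]
        linear_combination -(α 0 / t 0) * ht j hj.ne'
  have h0 : ℓ (y * y) = ∑ j ∈ Finset.range (n + 1), α j := by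
    simpa [weightMoment_zero_left] using hα 0
  have h1 : ∑ j ∈ Finset.range (n + 1), α j = α 0 / t 0 * ∑ j ∈ Finset.range (n + 1), t j := by
    rw [Finset.mul_sum]
    exact Finset.sum_congr rfl fun j _ => key j
  have h2 : ∑ j ∈ Finset.range (n + 1), α j * weightMoment lam k j =
      α 0 / t 0 * ∑ j ∈ Finset.range (n + 1), t j * weightMoment lam k j := by
    rw [Finset.mul_sum]
    exact Finset.sum_congr rfl fun j _ => by rw [key j, mul_assoc]
  rw [hα k, h0, h1, h2]
  ring

theorem functional_sq_mul_T_eq (hlam : -(1 / 2) < lam)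
    (hℓ : ∀ p, ℓ ((1 - X ^ 2) * derivative p - C (2 * lam + 1) * X * p) = 0) {n : ℕ} {y : ℝ[X]}
    (hy : y.natDegree = n) (h : gegenbauerOp lam y + C (n * (n + 2 * lam)) * y = 0)
    (hne : ℓ (y * y) ≠ 0) {k : ℕ} (hk : k ≠ 0 ∨ lam ≠ 0) :
    ℓ (y * y * Chebyshev.T ℝ (2 * k : ℕ)) / ℓ (y * y) =
      (n + lam) / n.factorial *
        ∑ j ∈ Finset.range (n + 1), gegenbauerCoeff lam n j * weightMoment lam k j := by
  have hf : (n.factorial : ℝ) ≠ 0 := by positivity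
  have hn0 : (0 : ℝ) ≤ n := Nat.cast_nonneg n
  have hrec : ∀ j : ℕ, j ≠ 0 →
      (j + 2 * lam) * (j + 1) * (j + lam + 1) * gegenbauerCoeff lam n (j + 1) =
      -(j + lam) * (n - j) * (n + j + 2 * lam) * gegenbauerCoeff lam n j := fun j hj => by
    have : (1 : ℝ) ≤ j := by exact_mod_cast Nat.pos_of_ne_zero hj
    exact gegenbauerCoeff_succ lam n j (by linarith) (by linarith)
  by_cases hl : lam = 0
  · have hk0 : k ≠ 0 := by tauto
    -- For `λ = 0` and `k ≥ 1` the `j = 0` term drops out, so only the normalization sees the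
    -- limiting coefficient.
    have hw : weightMoment lam k 0 = 0 := by
      rw [weightMoment, pochhammerSymbol_eq_zero (Nat.pos_of_ne_zero hk0) (by simp [hl]), zero_div]
    by_cases hn : n = 0
    · have := functional_sq_mul_T_mul_sum hlam hℓ hy h (t := fun j => if j = 0 then 1 else 0)
        (by simp) (by simp [hn]) (fun j hj => by simp [hj]) k
      subst hn
      simp only [zero_add, Finset.sum_range_one, if_true, hw, mul_zero, mul_one] at this ⊢
      rw [this, zero_div]
    · have hn' : (n : ℝ) ≠ 0 := by exact_mod_cast hn
      have hfac : (n.factorial : ℝ) = n * (n - 1).factorial := by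
        exact_mod_cast (Nat.mul_factorial_pred hn).symm
      have := functional_sq_mul_T_mul_sum hlam hℓ hy h
        (t := fun j => if j = 0 then 2 * ((n - 1).factorial : ℝ) else gegenbauerCoeff lam n j)
        (by simp; positivity)
        (by
          simp only [one_ne_zero, if_false, if_true, hl, gegenbauerCoeff, Nat.choose_one_right,
            Nat.cast_one, mul_zero, zero_add, add_zero, pochhammerSymbol_one, hfac]
          ring)
        (fun j hj => by simpa [hj] using hrec j hj) k
      have hs := sum_gegenbauerCoeff_zero hn
      rw [Finset.sum_range_succ', Finset.sum_range_succ'] at this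
      simp only [Nat.add_eq_zero_iff, one_ne_zero, and_false, if_false, if_true, hw, mul_zero,
        add_zero] at this
      rw [add_comm, hl] at this
      rw [hs] at this
      rw [Finset.sum_range_succ', hw, hl]
      simp only [mul_zero, add_zero]
      field_simp at this ⊢
      linear_combination this
  · have h2 : ∀ i : ℕ, 2 * lam + i ≠ 0 := by
      rintro (_ | i)
      · simpa using hl
      · have : (0 : ℝ) ≤ i := Nat.cast_nonneg i
        push_cast
        linarith
    have hnl : (n : ℝ) + lam ≠ 0 := by
      rcases n with _ | n
      · simpa using hl
      · have : (0 : ℝ) ≤ n := Nat.cast_nonneg n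
        push_cast
        linarith
    have ht0 : gegenbauerCoeff lam n 0 ≠ 0 := by
      simp only [gegenbauerCoeff, pow_zero, Nat.choose_zero_right, Nat.cast_one, one_mul,
        Nat.cast_zero, zero_add, add_zero]
      exact div_ne_zero (pochhammerSymbol_ne_zero fun i _ => h2 i) hl
    have ht1 : 2 * (lam + 1) * gegenbauerCoeff lam n 1 =
        -(n * (n + 2 * lam)) * gegenbauerCoeff lam n 0 := by
      have := gegenbauerCoeff_succ lam n 0 (by simpa using hl)
        (by simp only [Nat.cast_zero]; linarith)
      simp only [Nat.cast_zero, zero_add, add_zero, sub_zero] at this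
      apply mul_left_cancel₀ hl
      linear_combination this
    have := functional_sq_mul_T_mul_sum hlam hℓ hy h ht0 ht1 hrec k
    rw [sum_gegenbauerCoeff hlam hl] at this
    field_simp at this ⊢
    linear_combination this

end Functional

/-! ### The Gegenbauer measure. -/

theorem gegenbauerConst_pos {lam : ℝ} (hlam : -(1 / 2) < lam) : 0 < gegenbauerConst lam :=
  div_pos (Real.Gamma_pos_of_pos (by linarith))
    (mul_pos (Real.sqrt_pos.2 Real.pi_pos) (Real.Gamma_pos_of_pos (by linarith)))

theorem intervalIntegrable_one_sub_sq_rpow {a : ℝ} (ha : -1 < a) :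
    IntervalIntegrable (fun x : ℝ => (1 - x ^ 2) ^ a) volume (-1) 1 := by
  -- On `[0, 1]` the weight is the integrable `(1 - x)^a` times the continuous `(1 + x)^a`; the
  -- other half follows by reflection.
  have h1 : IntervalIntegrable (fun x : ℝ => (1 - x ^ 2) ^ a) volume 0 1 := by
    have h := ((intervalIntegral.intervalIntegrable_rpow' (a := 0) (b := 1) ha).comp_sub_left
      1).symm
    rw [sub_zero, sub_self] at h
    have hc : ContinuousOn (fun x : ℝ => (1 + x) ^ a) (Set.uIcc 0 1) := by
      refine ContinuousOn.rpow_const (by fun_prop) fun x hx => Or.inl ?_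
      rw [Set.uIcc_of_le zero_le_one] at hx
      linarith [hx.1]
    refine (h.mul_continuousOn hc).congr fun x hx => ?_
    rw [Set.uIoc_of_le zero_le_one] at hx
    rw [← Real.mul_rpow (by linarith [hx.2]) (by linarith [hx.1])]
    ring_nf
  have h2 : IntervalIntegrable (fun x : ℝ => (1 - x ^ 2) ^ a) volume (-1) 0 := by
    rw [IntervalIntegrable.iff_comp_neg]
    simpa using h1.symm
  exact h2.trans h1

theorem integrableOn_one_sub_sq_rpow_mul {a : ℝ} (ha : -1 < a) (p : ℝ[X]) :
    IntegrableOn (fun x : ℝ => (1 - x ^ 2) ^ a * p.eval x) (Set.Icc (-1) 1) := by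
  rw [integrableOn_Icc_iff_integrableOn_Ioc,
    ← intervalIntegrable_iff_integrableOn_Ioc_of_le (by norm_num)]
  exact (intervalIntegrable_one_sub_sq_rpow ha).mul_continuousOn p.continuous.continuousOn

theorem measurable_gegenbauerDensity (lam : ℝ) : Measurable fun x : ℝ =>
    ENNReal.ofReal (gegenbauerConst lam * (1 - x ^ 2) ^ (lam - 1 / 2)) := by
  fun_prop

theorem toReal_gegenbauerDensity {lam : ℝ} (hlam : -(1 / 2) < lam) {x : ℝ}
    (hx : x ∈ Set.Icc (-1 : ℝ) 1) :
    (ENNReal.ofReal (gegenbauerConst lam * (1 - x ^ 2) ^ (lam - 1 / 2))).toReal =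
      gegenbauerConst lam * (1 - x ^ 2) ^ (lam - 1 / 2) := by
  refine ENNReal.toReal_ofReal (mul_nonneg (gegenbauerConst_pos hlam).le (Real.rpow_nonneg ?_ _))
  nlinarith [hx.1, hx.2]

theorem integrable_eval_gegenbauerMeasure {lam : ℝ} (hlam : -(1 / 2) < lam) (p : ℝ[X]) :
    Integrable (fun x => p.eval x) (gegenbauerMeasure lam) := by
  rw [gegenbauerMeasure, integrable_withDensity_iff_integrable_smul'
    (measurable_gegenbauerDensity lam) (ae_of_all _ fun _ => ENNReal.ofReal_lt_top)]
  have h := (integrableOn_one_sub_sq_rpow_mul (a := lam - 1 / 2) (by linarith) p).const_mul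
    (gegenbauerConst lam)
  refine h.congr ((ae_restrict_mem measurableSet_Icc).mono fun x hx => ?_)
  simp only
  rw [toReal_gegenbauerDensity hlam hx, smul_eq_mul, mul_assoc]

theorem integral_eval_gegenbauerMeasure {lam : ℝ} (hlam : -(1 / 2) < lam) (p : ℝ[X]) :
    ∫ x, p.eval x ∂gegenbauerMeasure lam =
      gegenbauerConst lam * ∫ x in (-1)..1, (1 - x ^ 2) ^ (lam - 1 / 2) * p.eval x := by
  rw [gegenbauerMeasure, integral_withDensity_eq_integral_toReal_smul
    (measurable_gegenbauerDensity lam) (ae_of_all _ fun _ => ENNReal.ofReal_lt_top),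
    intervalIntegral.integral_of_le (by norm_num), ← integral_Icc_eq_integral_Ioc,
    ← integral_const_mul]
  refine setIntegral_congr_fun measurableSet_Icc fun x hx => ?_
  rw [toReal_gegenbauerDensity hlam hx, smul_eq_mul, mul_assoc]

/-- Integration by parts against the Gegenbauer weight. -/
theorem integral_gegenbauer_pearson {lam : ℝ} (hlam : -(1 / 2) < lam) (p : ℝ[X]) :
    ∫ x, ((1 - X ^ 2) * derivative p - C (2 * lam + 1) * X * p).eval x
      ∂gegenbauerMeasure lam = 0 := by
  rw [integral_eval_gegenbauerMeasure hlam]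
  have hI := integrableOn_one_sub_sq_rpow_mul (a := lam - 1 / 2) (by linarith)
    ((1 - X ^ 2) * derivative p - C (2 * lam + 1) * X * p)
  rw [integrableOn_Icc_iff_integrableOn_Ioc,
    ← intervalIntegrable_iff_integrableOn_Ioc_of_le (by norm_num)] at hI
  -- The integrand is the derivative of `(1 - x²)^(λ + 1/2) p`, which vanishes at both ends because
  -- `λ + 1/2 > 0`.
  have h := intervalIntegral.integral_eq_sub_of_hasDerivAt_of_le (a := -1) (b := 1)
    (f := fun x => (1 - x ^ 2) ^ (lam + 1 / 2) * p.eval x) (by norm_num)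
    (ContinuousOn.mul (ContinuousOn.rpow_const (by fun_prop) fun x _ => Or.inr (by linarith))
      p.continuous.continuousOn) (fun x hx => ?_) hI
  · have h0 : (0 : ℝ) ^ (lam + 1 / 2) = 0 := Real.zero_rpow (by linarith)
    rw [h]
    norm_num [h0]
  · have hpos : 0 < 1 - x ^ 2 := by nlinarith [hx.1, hx.2]
    have hd : HasDerivAt (fun x : ℝ => 1 - x ^ 2) (-(2 * x)) x := by
      simpa using (hasDerivAt_pow 2 x).const_sub 1
    have hr := (hd.rpow_const (p := lam + 1 / 2) (Or.inl hpos.ne')).mul (p.hasDerivAt x)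
    refine hr.congr_deriv ?_
    have e : (1 - x ^ 2) ^ (lam + 1 / 2) = (1 - x ^ 2) ^ (lam - 1 / 2) * (1 - x ^ 2) := by
      rw [← Real.rpow_add_one hpos.ne']
      ring_nf
    rw [e, show lam + 1 / 2 - 1 = lam - 1 / 2 by ring]
    simp only [eval_sub, eval_mul, eval_one, eval_pow, eval_X, eval_C]
    ring

theorem integral_gegenbauer_sq_pos {lam : ℝ} (hlam : -(1 / 2) < lam) {p : ℝ[X]} (hp : p ≠ 0) :
    0 < ∫ x, (p * p).eval x ∂gegenbauerMeasure lam := by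
  rw [integral_eval_gegenbauerMeasure hlam]
  refine mul_pos (gegenbauerConst_pos hlam) ?_
  have hI := integrableOn_one_sub_sq_rpow_mul (a := lam - 1 / 2) (by linarith) (p * p)
  rw [intervalIntegral.integral_of_le (by norm_num), ← integral_Icc_eq_integral_Ioc]
  have hnn : ∀ x ∈ Set.Icc (-1 : ℝ) 1, 0 ≤ (1 - x ^ 2) ^ (lam - 1 / 2) * (p * p).eval x := by
    intro x hx
    rw [eval_mul]
    exact mul_nonneg (Real.rpow_nonneg (by nlinarith [hx.1, hx.2]) _) (mul_self_nonneg _)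
  rw [setIntegral_pos_iff_support_of_nonneg_ae
    ((ae_restrict_mem measurableSet_Icc).mono hnn) hI]
  have hsub : Set.Ioo (-1 : ℝ) 1 \ {x | p.IsRoot x} ⊆
      Function.support (fun x : ℝ => (1 - x ^ 2) ^ (lam - 1 / 2) * (p * p).eval x) ∩
        Set.Icc (-1) 1 := by
    intro x hx
    refine ⟨?_, Set.Ioo_subset_Icc_self hx.1⟩
    have hpos : 0 < 1 - x ^ 2 := by nlinarith [hx.1.1, hx.1.2]
    have hr : p.eval x ≠ 0 := hx.2
    rw [Function.mem_support, eval_mul]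
    exact mul_ne_zero (Real.rpow_pos_of_pos hpos _).ne' (mul_ne_zero hr hr)
  refine lt_of_lt_of_le ?_ (measure_mono hsub)
  rw [measure_sdiff_null ((finite_setOfPred_isRoot hp).measure_zero _), Real.volume_Ioo]
  norm_num

theorem chebyshevMoment_eq {μ : Measure ℝ} (hμ : ∀ p : ℝ[X], Integrable (fun x => p.eval x) μ)
    (k n : ℕ) :
    chebyshevMoment μ k n =
      integralFunctional hμ (monicOrthogonalPoly μ n * monicOrthogonalPoly μ n *
        Chebyshev.T ℝ (k : ℕ)) /
      integralFunctional hμ (monicOrthogonalPoly μ n * monicOrthogonalPoly μ n) := by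
  set P := monicOrthogonalPoly μ n with hP
  have hsq : ∫ x, P.eval x ^ 2 ∂μ = integralFunctional hμ (P * P) := by
    simp [integralFunctional_apply, sq]
  have hnn : 0 ≤ integralFunctional hμ (P * P) := by
    rw [← hsq]
    exact integral_nonneg fun x => sq_nonneg _
  have hmeas : Measurable fun x => ENNReal.ofReal ((orthonormalPoly μ n).eval x ^ 2) :=
    ENNReal.measurable_ofReal.comp ((orthonormalPoly μ n).continuous.measurable.pow_const 2)
  rw [chebyshevMoment, squaredMeasure, integral_withDensity_eq_integral_toReal_smul hmeas
    (ae_of_all _ fun _ => ENNReal.ofReal_lt_top), div_eq_inv_mul,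
    integralFunctional_apply hμ (P * P * _), ← integral_const_mul]
  refine integral_congr_ae (ae_of_all _ fun x => ?_)
  simp only
  rw [ENNReal.toReal_ofReal (sq_nonneg _), orthonormalPoly, ← hP, hsq, eval_mul, eval_C, mul_pow,
    inv_pow, Real.sq_sqrt hnn, eval_mul, eval_mul, smul_eq_mul]
  ring

/-- The moments of the Gegenbauer polynomials as a finite sum. -/
theorem gegenbauerMoment_eq {lam : ℝ} (hlam : -(1 / 2) < lam) (n : ℕ) {k : ℕ}
    (hk : k ≠ 0 ∨ lam ≠ 0) :
    gegenbauerMoment lam (2 * k) n = (n + lam) / n.factorial *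
      ∑ j ∈ Finset.range (n + 1), gegenbauerCoeff lam n j * weightMoment lam k j := by
  have hμ := integrable_eval_gegenbauerMeasure hlam
  have hpos : ∀ p : ℝ[X], p ≠ 0 → 0 < integralFunctional hμ (p * p) :=
    fun p hp => integral_gegenbauer_sq_pos hlam hp
  have hℓ : ∀ p, integralFunctional hμ
      ((1 - X ^ 2) * derivative p - C (2 * lam + 1) * X * p) = 0 :=
    integral_gegenbauer_pearson hlam
  obtain ⟨hmon, hdeg⟩ := monicOrthogonalPoly_monic_natDegree (gegenbauerMeasure lam) n
  rw [gegenbauerMoment, chebyshevMoment_eq hμ]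
  exact functional_sq_mul_T_eq hlam hℓ hdeg
    (gegenbauerOp_eq_of_orthogonal hℓ hpos hdeg (monicOrthogonalPoly_orthogonal hμ hpos n))
    (hpos _ hmon.ne_zero).ne' hk

/-! ### The Gamma function form. -/

theorem Gamma_add_nat_eq (x : ℝ) (k : ℕ) (h : ∀ i < k, x + i ≠ 0) :
    Real.Gamma (x + k) = pochhammerSymbol x k * Real.Gamma x := by
  induction k with
  | zero => simp [pochhammerSymbol_zero]
  | succ k ih =>
    rw [pochhammerSymbol_succ, Nat.cast_succ, ← add_assoc, Real.Gamma_add_one (h k (by omega)),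
      ih fun i hi => h i (by omega)]
    ring

/-- Reflection applied to `(-a)_k = Γ(k - a) / Γ(-a)`. The product form also covers nonnegative
integers `a`, where both sides are zero. -/
theorem pochhammerSymbol_neg_mul_pi {a : ℝ} (ha : -1 < a) {k : ℕ} (hk : a < k) :
    pochhammerSymbol (-a) k * Real.pi =
      -Real.sin (Real.pi * a) * Real.Gamma (a + 1) * Real.Gamma (k - a) := by
  by_cases h : ∃ i < k, -a + (i : ℝ) = 0
  · obtain ⟨i, hi, h⟩ := h
    rw [pochhammerSymbol_eq_zero hi h, show a = i by linarith, mul_comm Real.pi,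
      Real.sin_nat_mul_pi]
    ring
  · push Not at h
    have hG : Real.Gamma (k - a) = pochhammerSymbol (-a) k * Real.Gamma (-a) := by
      rw [← Gamma_add_nat_eq _ _ h]; ring_nf
    have hr := Real.Gamma_mul_Gamma_one_sub (-a)
    have hG0 : Real.sin (Real.pi * -a) ≠ 0 := by
      intro hs
      rw [hs, div_zero] at hr
      refine mul_ne_zero (Real.Gamma_ne_zero fun m hm => ?_) (Real.Gamma_ne_zero fun m hm => ?_) hr
      · exact h m (by exact_mod_cast (show (m : ℝ) < k by linarith)) (by rw [hm]; ring)
      · have hm0 : (0 : ℝ) ≤ m := Nat.cast_nonneg m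
        linarith
    rw [eq_div_iff hG0, sub_neg_eq_add, mul_neg, Real.sin_neg, add_comm 1 a] at hr
    rw [hG]
    linear_combination -pochhammerSymbol (-a) k * hr

theorem neg_one_pow_mul_weightMoment {lam : ℝ} (hlam : -(1 / 2) < lam) {j k : ℕ}
    (hk : (j : ℝ) + lam < k) :
    (-1) ^ j * weightMoment lam k j = -Real.sin (Real.pi * lam) / Real.pi *
      (Real.Gamma (j + lam + 1) ^ 2 *
        (Real.Gamma (k - j - lam) / Real.Gamma (k + j + lam + 1))) := by
  have hj : (0 : ℝ) ≤ j := Nat.cast_nonneg j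
  have h1 := pochhammerSymbol_neg_mul_pi (by linarith) hk
  have h2 := Gamma_add_nat_eq (j + lam + 1) k fun i _ => by
    have : (0 : ℝ) ≤ i := Nat.cast_nonneg i
    linarith
  -- This sign is what cancels the alternation of the first sum.
  have h3 : Real.sin (Real.pi * (j + lam)) = (-1) ^ j * Real.sin (Real.pi * lam) := by
    rw [← Real.sin_add_nat_mul_pi]; ring_nf
  have hG : Real.Gamma (j + lam + 1) ≠ 0 := (Real.Gamma_pos_of_pos (by linarith)).ne'
  have hp : pochhammerSymbol (j + lam + 1) k ≠ 0 := pochhammerSymbol_ne_zero fun i _ => by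
    have : (0 : ℝ) ≤ i := Nat.cast_nonneg i
    linarith
  have hs : ((-1 : ℝ) ^ j) * (-1) ^ j = 1 := by rw [← mul_pow]; simp
  have hpi := Real.pi_ne_zero
  rw [weightMoment, show (k : ℝ) + j + lam + 1 = j + lam + 1 + k by ring, h2,
    show (k : ℝ) - j - lam = k - (j + lam) by ring, show -(j : ℝ) - lam = -(j + lam) by ring]
  rw [h3] at h1
  generalize Real.sin (Real.pi * lam) = s at h1 ⊢
  field_simp
  linear_combination (-1) ^ j * h1 -
    s * Real.Gamma (j + lam + 1) * Real.Gamma (k - (j + lam)) * hs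

theorem gegenbauerMoment_eq_Gamma {lam : ℝ} (hlam : -(1 / 2) < lam) {n k : ℕ}
    (hk : (n : ℝ) + lam < k) :
    gegenbauerMoment lam (2 * k) n =
      -Real.sin (Real.pi * lam) * (((n : ℝ) + lam) / (Real.pi * (n.factorial : ℝ))) *
        ∑ j ∈ Finset.range (n + 1),
          (n.choose j : ℝ) * (pochhammerSymbol (2 * lam + j) n / ((j : ℝ) + lam)) *
            Real.Gamma ((j : ℝ) + lam + 1) ^ 2 *
            (Real.Gamma ((k : ℝ) - j - lam) / Real.Gamma ((k : ℝ) + j + lam + 1)) := by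
  have hk0 : k ≠ 0 ∨ lam ≠ 0 := by
    by_contra! h
    have : (0 : ℝ) ≤ n := Nat.cast_nonneg n
    rw [h.1, h.2] at hk
    simp only [Nat.cast_zero] at hk
    linarith
  rw [gegenbauerMoment_eq hlam n hk0, Finset.mul_sum, Finset.mul_sum]
  refine Finset.sum_congr rfl fun j hj => ?_
  have hjn : (j : ℝ) ≤ n := by exact_mod_cast Nat.lt_succ_iff.1 (Finset.mem_range.1 hj)
  have h := neg_one_pow_mul_weightMoment hlam (j := j) (k := k) (by linarith)
  rw [gegenbauerCoeff]
  have e : ((n : ℝ) + lam) / (Real.pi * (n.factorial : ℝ)) =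
    ((n : ℝ) + lam) / (n.factorial : ℝ) * (1 / Real.pi) := by field_simp
  rw [e]
  linear_combination ((n : ℝ) + lam) / n.factorial *
    (n.choose j * (pochhammerSymbol (2 * lam + j) n / ((j : ℝ) + lam))) * h

/-! ### Monotonicity in `k`, vanishing and decay. -/

theorem pochhammerSymbol_nonneg {a : ℝ} (ha : 0 ≤ a) (k : ℕ) : 0 ≤ pochhammerSymbol a k := by
  induction k with
  | zero => simp [pochhammerSymbol_zero]
  | succ k ih => rw [pochhammerSymbol_succ]; positivity

/-- The factor `n + λ` matters only for `n = j = 0` and `λ < 0`, where it offsets the sign of `1/λ`.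
For `j = 0 < n`, a negative `λ` cancels from `(2λ)_n / λ`. -/
theorem add_mul_pochhammerSymbol_div_nonneg {lam : ℝ} (hlam : -(1 / 2) < lam) {n j : ℕ}
    (hj : j ≤ n) : 0 ≤ (n + lam) * (pochhammerSymbol (2 * lam + j) n / (j + lam)) := by
  rcases j with _ | j
  · rcases n with _ | n
    · rcases eq_or_ne lam 0 with rfl | h
      · simp
      · simp [pochhammerSymbol_zero, h]
    · rw [Nat.cast_zero, add_zero, zero_add, pochhammerSymbol_succ_left]
      have hn : (0 : ℝ) ≤ n := Nat.cast_nonneg n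
      have h1 : 0 ≤ pochhammerSymbol (2 * lam + 1) n := pochhammerSymbol_nonneg (by linarith) n
      refine mul_nonneg (by push_cast; linarith) ?_
      rcases eq_or_ne lam 0 with rfl | h
      · simp
      · rw [show 2 * lam * pochhammerSymbol (2 * lam + 1) n / lam =
          2 * pochhammerSymbol (2 * lam + 1) n by field_simp]
        positivity
  · have hj0 : (0 : ℝ) ≤ j := Nat.cast_nonneg j
    have hn : ((j + 1 : ℕ) : ℝ) ≤ n := by exact_mod_cast hj
    push_cast at hn ⊢
    exact mul_nonneg (by linarith) (div_nonneg (pochhammerSymbol_nonneg (by linarith) n)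
      (by linarith))

theorem Gamma_ratio_succ_le {a x : ℝ} (ha : -(1 / 2) < a) (hx : a < x) :
    Real.Gamma (x + 1 - a) / Real.Gamma (x + 1 + a + 1) ≤
      Real.Gamma (x - a) / Real.Gamma (x + a + 1) := by
  have hpos : 0 < x + a + 1 := by linarith
  rw [show x + 1 - a = x - a + 1 by ring, show x + 1 + a + 1 = x + a + 1 + 1 by ring,
    Real.Gamma_add_one (by linarith), Real.Gamma_add_one hpos.ne', mul_div_mul_comm]
  have h1 : 0 < Real.Gamma (x - a) := Real.Gamma_pos_of_pos (by linarith)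
  have h2 : 0 < Real.Gamma (x + a + 1) := Real.Gamma_pos_of_pos hpos
  refine mul_le_of_le_one_left (by positivity) ?_
  rw [div_le_one hpos]
  linarith

theorem abs_gegenbauerMoment_succ_le {lam : ℝ} (hlam : -(1 / 2) < lam) {n k : ℕ}
    (hk : (n : ℝ) + lam < k) :
    |gegenbauerMoment lam (2 * k + 2) n| ≤ |gegenbauerMoment lam (2 * k) n| := by
  have hk' : (n : ℝ) + lam < (k + 1 : ℕ) := by push_cast; linarith
  rw [show 2 * k + 2 = 2 * (k + 1) by ring, gegenbauerMoment_eq_Gamma hlam hk,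
    gegenbauerMoment_eq_Gamma hlam hk']
  -- Keeping `n + λ` with the sum makes every term nonnegative, so the absolute values can be
  -- compared termwise.
  have e : ∀ S : ℝ, -Real.sin (Real.pi * lam) * (((n : ℝ) + lam) / (Real.pi * n.factorial)) * S =
      -Real.sin (Real.pi * lam) / (Real.pi * n.factorial) * ((n + lam) * S) := fun S => by ring
  rw [e, e, abs_mul (-Real.sin (Real.pi * lam) / _), abs_mul (-Real.sin (Real.pi * lam) / _)]
  refine mul_le_mul_of_nonneg_left ?_ (abs_nonneg _)
  simp only [Finset.mul_sum]
  have key : ∀ j ∈ Finset.range (n + 1), ∀ x : ℝ, (n : ℝ) + lam < x → 0 ≤ (n + lam) *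
      ((n.choose j : ℝ) * (pochhammerSymbol (2 * lam + j) n / ((j : ℝ) + lam)) *
            Real.Gamma ((j : ℝ) + lam + 1) ^ 2 *
            (Real.Gamma (x - j - lam) / Real.Gamma (x + j + lam + 1))) := by
    intro j hj x hx
    have hj := Nat.lt_succ_iff.1 (Finset.mem_range.1 hj)
    have hjn : (j : ℝ) ≤ n := by exact_mod_cast hj
    have hj0 : (0 : ℝ) ≤ j := Nat.cast_nonneg j
    have h1 := add_mul_pochhammerSymbol_div_nonneg hlam hj
    have h2 : 0 < Real.Gamma (x - j - lam) := Real.Gamma_pos_of_pos (by linarith)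
    have h3 : 0 < Real.Gamma (x + j + lam + 1) := Real.Gamma_pos_of_pos (by linarith)
    have := mul_nonneg h1 (show 0 ≤ (n.choose j : ℝ) * Real.Gamma ((j : ℝ) + lam + 1) ^ 2 *
      (Real.Gamma (x - j - lam) / Real.Gamma (x + j + lam + 1)) by positivity)
    linarith
  have hs := Finset.sum_nonneg fun j hj => key j hj _ hk
  have hs' := Finset.sum_nonneg fun j hj => key j hj _ hk'
  rw [abs_of_nonneg hs, abs_of_nonneg hs']
  refine Finset.sum_le_sum fun j hj => ?_
  have hj := Nat.lt_succ_iff.1 (Finset.mem_range.1 hj)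
  have hjn : (j : ℝ) ≤ n := by exact_mod_cast hj
  have hj0 : (0 : ℝ) ≤ j := Nat.cast_nonneg j
  have h1 := add_mul_pochhammerSymbol_div_nonneg hlam hj
  have h2 := Gamma_ratio_succ_le (a := j + lam) (x := k) (by linarith) (by linarith)
  have h3 : 0 ≤ (n.choose j : ℝ) * Real.Gamma ((j : ℝ) + lam + 1) ^ 2 := by positivity
  have := mul_le_mul_of_nonneg_left h2 (mul_nonneg h1 h3)
  simp only [← add_assoc, ← sub_sub] at this
  push_cast
  linarith

theorem gegenbauerMoment_eq_zero {l : ℕ} {n k : ℕ} (hk : n + l + 1 ≤ k) :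
    gegenbauerMoment l (2 * k) n = 0 := by
  have hl : -(1 / 2) < (l : ℝ) := by
    have : (0 : ℝ) ≤ l := Nat.cast_nonneg l
    linarith
  rw [gegenbauerMoment_eq hl n (Or.inl (by omega)), Finset.sum_eq_zero, mul_zero]
  intro j hj
  have hj := Finset.mem_range.1 hj
  rw [weightMoment, pochhammerSymbol_eq_zero (i := j + l) (by omega) (by push_cast; ring)]
  simp

theorem pochhammerSymbol_eq_prod (a : ℝ) (k : ℕ) :
    pochhammerSymbol a k = ∏ i ∈ Finset.range k, (a + i) := by
  induction k with
  | zero => simp [pochhammerSymbol_zero]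
  | succ k ih => rw [pochhammerSymbol_succ, Finset.prod_range_succ, ih]

open Filter Asymptotics in
theorem weightMoment_isBigO {lam : ℝ} (hlam : -(1 / 2) < lam) (j : ℕ) :
    (fun k : ℕ => weightMoment lam k j) =O[atTop] fun k : ℕ => 1 / (k : ℝ) ^ (2 * lam + 1) := by
  set a : ℝ := j + lam with ha
  have hj : (0 : ℝ) ≤ j := Nat.cast_nonneg j
  by_cases h : ∃ i : ℕ, -a + (i : ℝ) = 0
  · obtain ⟨i, hi⟩ := h
    refine IsBigO.congr' (isBigO_zero _ _) ?_ EventuallyEq.rfl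
    filter_upwards [eventually_gt_atTop i] with k hk
    rw [weightMoment, pochhammerSymbol_eq_zero hk (by linarith), zero_div]
  · push Not at h
    have hG : Real.Gamma (-a) ≠ 0 := Real.Gamma_ne_zero fun m hm => h m (by rw [hm]; ring)
    have hp1 : ∀ k, pochhammerSymbol (-a) k ≠ 0 := fun k => pochhammerSymbol_ne_zero fun i _ => h i
    have hne : ∀ i : ℕ, a + 1 + i ≠ 0 := fun i => by
      have : (0 : ℝ) ≤ i := Nat.cast_nonneg i
      linarith
    have hp2 : ∀ k, pochhammerSymbol (a + 1) k ≠ 0 := fun k => pochhammerSymbol_ne_zero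
      fun i _ => hne i
    -- This convergent product equals `k^(2a + 1) (-a)_k / (a + 1)_k`; the last factor corrects for
    -- `Real.GammaSeq` having `k + 1` factors in its denominator.
    have hlim := ((Real.GammaSeq_tendsto_Gamma (a + 1)).div (Real.GammaSeq_tendsto_Gamma (-a))
      hG).mul (tendsto_add_mul_div_add_mul_atTop_nhds (a + 1) (-a) 1 (one_ne_zero (α := ℝ)))
    have h1 : (fun k : ℕ => (k : ℝ) ^ (-(2 * a + 1))) =O[atTop]
        fun k : ℕ => 1 / (k : ℝ) ^ (2 * lam + 1) := by
      refine IsBigO.of_bound 1 ?_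
      filter_upwards [eventually_ge_atTop 1] with k hk
      have hk1 : (1 : ℝ) ≤ k := by exact_mod_cast hk
      rw [one_div, ← Real.rpow_neg (by linarith), one_mul,
        Real.norm_of_nonneg (by positivity), Real.norm_of_nonneg (by positivity)]
      exact Real.rpow_le_rpow_of_exponent_le hk1 (by linarith)
    refine IsBigO.congr' ((hlim.isBigO_one ℝ).mul h1) ?_ (by simp)
    filter_upwards [eventually_ge_atTop 1] with k hk
    have hk0 : (0 : ℝ) < k := by exact_mod_cast hk
    have e1 : (k : ℝ) ^ (a + 1) = (k : ℝ) ^ (2 * a + 1) * (k : ℝ) ^ (-a) := by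
      rw [← Real.rpow_add hk0]; ring_nf
    have hx := h k
    have hy := hne k
    have hx2 : (k : ℝ) ^ (-a) ≠ 0 := (Real.rpow_pos_of_pos hk0 _).ne'
    have hx3 : (k : ℝ) ^ (2 * a + 1) ≠ 0 := (Real.rpow_pos_of_pos hk0 _).ne'
    have hx4 : (k.factorial : ℝ) ≠ 0 := by positivity
    have hp1k := hp1 k
    have hp2k := hp2 k
    rw [weightMoment, show -(j : ℝ) - lam = -a by rw [ha]; ring, ← ha, Pi.div_apply,
      Real.GammaSeq, Real.GammaSeq, ← pochhammerSymbol_eq_prod, ← pochhammerSymbol_eq_prod,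
      pochhammerSymbol_succ, pochhammerSymbol_succ, Real.rpow_neg hk0.le (2 * a + 1), e1, one_mul]
    field_simp

open Filter Asymptotics in
theorem abs_gegenbauerMoment_isBigO {lam : ℝ} (hlam : -(1 / 2) < lam) (n : ℕ) :
    (fun k : ℕ => |gegenbauerMoment lam (2 * k) n|) =O[atTop]
      fun k : ℕ => 1 / (k : ℝ) ^ (2 * lam + 1) := by
  refine IsBigO.abs_left ?_
  have h : (fun k : ℕ => ((n : ℝ) + lam) / n.factorial *
      ∑ j ∈ Finset.range (n + 1), gegenbauerCoeff lam n j * weightMoment lam k j) =O[atTop]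
      fun k : ℕ => 1 / (k : ℝ) ^ (2 * lam + 1) :=
    IsBigO.const_mul_left
      (IsBigO.fun_sum fun j _ => IsBigO.const_mul_left (weightMoment_isBigO hlam j) _) _
  refine h.congr' ?_ EventuallyEq.rfl
  filter_upwards [eventually_ge_atTop 1] with k hk
  exact (gegenbauerMoment_eq hlam n (Or.inl (by omega))).symm

theorem theorem4p2 (lam : ℝ) (hlam : -(1 / 2) < lam) (n : ℕ) :
    (∀ k : ℕ, 1 ≤ k →
      gegenbauerMoment lam (2 * k) n =
        ((n : ℝ) + lam) / (n.factorial : ℝ) *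
          ∑ j ∈ Finset.range (n + 1),
            (-1 : ℝ) ^ j * (n.choose j : ℝ) *
              (pochhammerSymbol (2 * lam + j) n / ((j : ℝ) + lam)) *
              (pochhammerSymbol (-(j : ℝ) - lam) k / pochhammerSymbol ((j : ℝ) + lam + 1) k)) ∧
    (∀ k : ℕ, (n : ℝ) + lam < k →
      gegenbauerMoment lam (2 * k) n =
        -Real.sin (Real.pi * lam) * (((n : ℝ) + lam) / (Real.pi * (n.factorial : ℝ))) *
          ∑ j ∈ Finset.range (n + 1),
            (n.choose j : ℝ) * (pochhammerSymbol (2 * lam + j) n / ((j : ℝ) + lam)) *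
              Real.Gamma ((j : ℝ) + lam + 1) ^ 2 *
              (Real.Gamma ((k : ℝ) - j - lam) / Real.Gamma ((k : ℝ) + j + lam + 1))) ∧
    (∀ l : ℕ, lam = l → ∀ k : ℕ, n + l + 1 ≤ k → gegenbauerMoment lam (2 * k) n = 0) ∧
    (∀ k : ℕ, (n : ℝ) + lam < k →
      |gegenbauerMoment lam (2 * k + 2) n| ≤ |gegenbauerMoment lam (2 * k) n|) ∧
    (fun k : ℕ => |gegenbauerMoment lam (2 * k) n|) =O[Filter.atTop]
      (fun k : ℕ => 1 / (k : ℝ) ^ (2 * lam + 1)) := by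
  refine ⟨fun k hk => ?_, fun k hk => gegenbauerMoment_eq_Gamma hlam hk, ?_,
    fun k hk => abs_gegenbauerMoment_succ_le hlam hk, abs_gegenbauerMoment_isBigO hlam n⟩
  · exact gegenbauerMoment_eq hlam n (Or.inl (by omega))
  · rintro l rfl k hk
    exact gegenbauerMoment_eq_zero hk
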